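/- Let $f\colon\{0,1\}^n\to\{0,1\}$ be a Boolean function, and let $U_f$ be the $(n+1)$-qubit unitary with $U_f|x\rangle|b\rangle=|x\rangle|b\oplus f(x)\rangle$ for all $x\in\{0,1\}^n$, $b\in\{0,1\}$. Then $$\mathcal{T}^{\mathrm{adaptive}}_0(U_f)\;\ge\;\mathrm{PDT}^{\mathrm{na}}(f)-1 .$$ Here $\mathrm{PDT}^{\mathrm{na}}(f)$, the non-adaptive parity decision tree complexity of $f$, is the least $k$ for which there are subsets $S_1,\dots,S_k\subseteq[n]$ and a function $g\colon\{0,1\}^k\to\{0,1\}$ with $f(x)=g\bigl(\bigoplus_{i\in S_1}x_i,\dots,\bigoplus_{i\in S_k}x_i\bigr)$ for all $x\in\{0,1\}^n$. An adaptive Clifford+$T$ circuit starts with an input state of the register and some number of ancilla qubits in the all-zeros state, and applies a sequence of Clifford unitaries, $T$ gates (with $T=\mathrm{diag}(1,e^{i\pi/4})$) and single-qubit measurements in the computational basis, where each step may depend, deterministically or probabilistically, on the measurement outcomes observed so far; at the end the ancilla qubits are discarded. Such a circuit defines a channel $\mathcal{E}$ on the register. Let $k(\psi)$ be the expected number of $T$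 gates it applies on the pure input state $|\psi\rangle$ (over the measurement outcomes and the randomness used), and let $k=\sup_{|\psi\rangle}k(\psi)$. For a unitary $U$ and $\epsilon\ge 0$, $\mathcal{T}^{\mathrm{adaptive}}_\epsilon(U)$ is the infimum of $k$ over all adaptive Clifford+$T$ circuits whose channel $\mathcal{E}$ is within diamond distance $\epsilon$ of the channel $\rho\mapsto U\rho U^\dagger$, the diamond distance of $\mathcal{E}_1$ and $\mathcal{E}_2$ being the supremum, over $\ell\in\mathbb{N}$ and over density matrices $\rho$ of the register together with $\ell$ further qubits, of $\tfrac12\|(\mathcal{E}_1\otimes I_\ell)(\rho)-(\mathcal{E}_2\otimes I_\ell)(\rho)\|_1$. -/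

import Mathlib

namespace CliffordT

noncomputable section

open Matrix
open scoped ComplexOrder MatrixOrder ENNReal NNReal

/-! ### Registers of qubits

A register of qubits is indexed by a finite type `Q` of qubit labels. Its computational basis
consists of the bit strings `Q → Bool`, so its states and operators are vectors and matrices
indexed by `Q → Bool`. -/

/-- Square complex matrices with rows and columns indexed by `ι`. -/
abbrev Op (ι : Type) : Type := Matrix ι ι ℂ

/-- `ρ` is a density matrix (a mixed state). -/
def IsDensity {ι : Type} [Fintype ι] (ρ : Op ι) : Prop :=
  ρ.PosSemidef ∧ ρ.trace = 1

/-- `ψ` is a unit vector (a pure state). -/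
def IsPure {ι : Type} [Fintype ι] (ψ : ι → ℂ) : Prop :=
  ∑ x, ‖ψ x‖ ^ 2 = 1

/-- The rank-one operator `|ψ⟩⟨ψ|`. -/
def ketbra {ι : Type} (ψ : ι → ℂ) : Op ι :=
  vecMulVec ψ (star ψ)

/-! ### Trace distance and diamond distance -/

/-- The trace norm `‖A‖₁ = Tr √(A† A)`. -/
def traceNorm {ι : Type} [Fintype ι] [DecidableEq ι] (A : Op ι) : ℝ :=
  (CFC.sqrt (Aᴴ * A)).trace.re

/-- The trace distance `D(ρ, σ) = ‖ρ - σ‖₁ / 2`. -/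
def traceDist {ι : Type} [Fintype ι] [DecidableEq ι] (ρ σ : Op ι) : ℝ :=
  traceNorm (ρ - σ) / 2

/-- The map `E ⊗ I`, with `I` the identity map on operators on a system with basis `κ`:
for all `k, l : κ` it applies `E` to the block `⟨k| ρ |l⟩` of the operator `ρ`. -/
def tensorId {ι : Type} (κ : Type) (E : Op ι →ₗ[ℂ] Op ι) (ρ : Op (ι × κ)) : Op (ι × κ) :=
  Matrix.of fun x y => E (Matrix.of fun i j => ρ (i, x.2) (j, y.2)) x.1 y.1

/-- The diamond distance of two maps on operators: the supremum, over the number `ℓ` of qubits of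
a reference system and over the density matrices `ρ` of the joint system, of the trace distance
of the images of `ρ`. -/
def diamondDist {ι : Type} [Fintype ι] [DecidableEq ι] (E₁ E₂ : Op ι →ₗ[ℂ] Op ι) : ℝ≥0∞ :=
  ⨆ (ℓ : ℕ) (ρ : Op (ι × (Fin ℓ → Bool))) (_ : IsDensity ρ),
    ENNReal.ofReal (traceDist (tensorId (Fin ℓ → Bool) E₁ ρ) (tensorId (Fin ℓ → Bool) E₂ ρ))

/-- The map `ρ ↦ A ρ A†`. -/
def conjMap {ι : Type} [Fintype ι] (A : Op ι) : Op ι →ₗ[ℂ] Op ι where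
  toFun ρ := A * ρ * Aᴴ
  map_add' ρ σ := by rw [Matrix.mul_add, Matrix.add_mul]
  map_smul' c ρ := by simp

/-! ### Pauli operators, Clifford unitaries, the `T` gate -/

/-- The tensor product `⨂ q, A q` of single-qubit operators. -/
def tensor {Q : Type} [Fintype Q] (A : Q → Op Bool) : Op (Q → Bool) :=
  Matrix.of fun x y => ∏ q, A q (x q) (y q)

/-- The single-qubit operator `A` acting on qubit `q`, and the identity on all the others. -/
def onQubit {Q : Type} [Fintype Q] [DecidableEq Q] (q : Q) (A : Op Bool) : Op (Q → Bool) :=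
  tensor (Function.update (fun _ => 1) q A)

/-- The matrix `X = |0⟩⟨1| + |1⟩⟨0|`. -/
def pauliX : Op Bool := Matrix.of fun x y => if x = y then 0 else 1

/-- The matrix `Z = diag(1, -1)`. -/
def pauliZ : Op Bool := Matrix.diagonal fun b => if b then -1 else 1

/-- The matrix `Y = i X Z`. -/
def pauliY : Op Bool := Complex.I • (pauliX * pauliZ)

/-- The Pauli group: all `c • (P₁ ⊗ P₂ ⊗ ⋯)` with `c ∈ {1, i, -1, -i}` and
`P₁, P₂, … ∈ {I, X, Y, Z}`. -/
def pauliGroup (Q : Type) [Fintype Q] : Set (Op (Q → Bool)) :=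
  {M | ∃ (k : ℕ) (P : Q → Op Bool),
    (∀ q, P q = 1 ∨ P q = pauliX ∨ P q = pauliY ∨ P q = pauliZ) ∧
      M = Complex.I ^ k • tensor P}

/-- `C` is a Clifford unitary: a unitary that maps the Pauli group into itself by conjugation. -/
def IsClifford {Q : Type} [Fintype Q] [DecidableEq Q] (C : Op (Q → Bool)) : Prop :=
  C ∈ Matrix.unitaryGroup (Q → Bool) ℂ ∧ ∀ P ∈ pauliGroup Q, C * P * Cᴴ ∈ pauliGroup Q

/-- The matrix `T = diag(1, exp(i π / 4))`. -/
def tMatrix : Op Bool :=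
  Matrix.diagonal fun b => if b then Complex.exp (Complex.I * (Real.pi / 4)) else 1

/-- The `T` gate on qubit `q`. -/
def tGate {Q : Type} [Fintype Q] [DecidableEq Q] (q : Q) : Op (Q → Bool) :=
  onQubit q tMatrix

/-- The projector onto the states in which qubit `q` is `|b⟩`. -/
def measProj {Q : Type} [Fintype Q] [DecidableEq Q] (q : Q) (b : Bool) : Op (Q → Bool) :=
  onQubit q (Matrix.single b b 1)

/-! ### Adaptive Clifford+`T` circuits -/

/-- Adaptive Clifford+`T` circuits on a register `Q`. After each single-qubit measurement in the
computational basis the rest of the circuit depends on the outcome. At any time the circuit can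
use classical randomness: it draws a number `i` from a probability distribution and continues with
the circuit `next i`. -/
inductive AdaptiveCircuit (Q : Type) [Fintype Q] [DecidableEq Q] : Type
  | halt : AdaptiveCircuit Q
  | clifford (C : Op (Q → Bool)) (hC : IsClifford C) (next : AdaptiveCircuit Q) :
      AdaptiveCircuit Q
  | t (q : Q) (next : AdaptiveCircuit Q) : AdaptiveCircuit Q
  | measure (q : Q) (next : Bool → AdaptiveCircuit Q) : AdaptiveCircuit Q
  | random (p : PMF ℕ) (next : ℕ → AdaptiveCircuit Q) : AdaptiveCircuit Q

section Circuits

variable {Q : Type} [Fintype Q] [DecidableEq Q]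

/-- The operator on the whole register with which the circuit ends when it starts with `ρ`,
averaged over the measurement outcomes and the randomness. -/
def AdaptiveCircuit.run : AdaptiveCircuit Q → Op (Q → Bool) → Op (Q → Bool)
  | .halt, ρ => ρ
  | .clifford C _ next, ρ => next.run (conjMap C ρ)
  | .t q next, ρ => next.run (conjMap (tGate q) ρ)
  | .measure q next, ρ => ∑ b, (next b).run (conjMap (measProj q b) ρ)
  | .random p next, ρ => ∑' i, ((p i).toReal : ℂ) • (next i).run ρ

/-- The expected number of `T` gates that the circuit applies when it starts with the state `ρ`,
over the measurement outcomes and the randomness. The recursion carries unnormalized states: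
the trace of `ρ` is the probability with which the present point of the circuit is reached. -/
def AdaptiveCircuit.expectedT : AdaptiveCircuit Q → Op (Q → Bool) → ℝ≥0∞
  | .halt, _ => 0
  | .clifford C _ next, ρ => next.expectedT (conjMap C ρ)
  | .t q next, ρ => ENNReal.ofReal ρ.trace.re + next.expectedT (conjMap (tGate q) ρ)
  | .measure q next, ρ => ∑ b, (next b).expectedT (conjMap (measProj q b) ρ)
  | .random p next, ρ => ∑' i, p i * (next i).expectedT ρ

end Circuits

/-! #### The series in `AdaptiveCircuit.run` converge, and `run` is linear -/

section Linearity

variable {Q : Type} [Fintype Q] [DecidableEq Q]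

theorem onQubit_diagonal (q : Q) (d : Bool → ℂ) :
    onQubit q (Matrix.diagonal d) = Matrix.diagonal fun x : Q → Bool => d (x q) := by
  ext x y
  simp only [onQubit, tensor, Matrix.of_apply]
  by_cases hxy : x = y
  · subst hxy
    rw [Finset.prod_eq_single q]
    · simp
    · intro r _ hr
      simp [Function.update_of_ne hr]
    · simp
  · rw [Matrix.diagonal_apply_ne _ hxy]
    obtain ⟨r, hr⟩ := Function.ne_iff.mp hxy
    refine Finset.prod_eq_zero (Finset.mem_univ r) ?_
    by_cases hrq : r = q
    · subst hrq
      simp [hr]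
    · simp [Function.update_of_ne hrq, hr]

theorem measProj_eq (q : Q) (b : Bool) :
    measProj q b = Matrix.diagonal fun x : Q → Bool => if x q = b then 1 else 0 := by
  have h : Matrix.single b b (1 : ℂ) = Matrix.diagonal fun c => if c = b then 1 else 0 := by
    ext x y
    cases b <;> cases x <;> cases y <;> simp
  rw [measProj, h, onQubit_diagonal]

theorem tGate_eq (q : Q) :
    tGate q = Matrix.diagonal fun x : Q → Bool =>
      if x q then Complex.exp (Complex.I * (Real.pi / 4)) else 1 := by
  rw [tGate, tMatrix, onQubit_diagonal]

theorem tGate_unitary (q : Q) : (tGate q)ᴴ * tGate q = 1 := by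
  rw [tGate_eq, Matrix.diagonal_conjTranspose, Matrix.diagonal_mul_diagonal,
    ← Matrix.diagonal_one]
  congr 1
  ext x
  simp only [Pi.star_apply]
  split_ifs
  · rw [RCLike.star_def, ← Complex.normSq_eq_conj_mul_self, Complex.normSq_eq_norm_sq]
    have : Complex.I * (Real.pi / 4 : ℂ) = ((Real.pi / 4 : ℝ) : ℂ) * Complex.I := by
      push_cast; ring
    rw [this, Complex.norm_exp_ofReal_mul_I]
    simp
  · simp

theorem trace_conjMap_unitary {ι : Type} [Fintype ι] [DecidableEq ι] {U : Op ι}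
    (hU : Uᴴ * U = 1) (ρ : Op ι) : (conjMap U ρ).trace = ρ.trace := by
  change (U * ρ * Uᴴ).trace = _
  rw [Matrix.trace_mul_comm, ← Matrix.mul_assoc, hU, Matrix.one_mul]

theorem trace_conjMap_measProj (q : Q) (ρ : Op (Q → Bool)) :
    ∑ b, (conjMap (measProj q b) ρ).trace = ρ.trace := by
  have h : ∀ b, (conjMap (measProj q b) ρ).trace = ((measProj q b) * ρ).trace := by
    intro b
    change (_ * ρ * _).trace = _
    rw [Matrix.trace_mul_comm, ← Matrix.mul_assoc]
    congr 2
    rw [measProj_eq, Matrix.diagonal_conjTranspose, Matrix.diagonal_mul_diagonal]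
    congr 1
    ext x
    by_cases hx : x q = b <;> simp [hx]
  simp_rw [h]
  rw [← Matrix.trace_sum, ← Matrix.sum_mul]
  have : ∑ b, measProj q b = 1 := by
    simp_rw [measProj_eq]
    ext x y
    by_cases hxy : x = y
    · subst hxy
      cases hx : x q <;> simp [hx]
    · simp [hxy]
  rw [this, Matrix.one_mul]

theorem norm_apply_le_trace {ι : Type} [Fintype ι] [DecidableEq ι] {A : Op ι}
    (hA : A.PosSemidef) (i j : ι) : ‖A i j‖ ≤ A.trace.re := by
  obtain ⟨B, rfl⟩ : ∃ B : Op ι, A = Bᴴ * B := by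
    obtain ⟨B, hB⟩ := CStarAlgebra.nonneg_iff_eq_star_mul_self.mp hA.nonneg
    exact ⟨B, hB⟩
  have hs : ∀ l, ∑ k, ‖B k l‖ ^ 2 ≤ ∑ l, ∑ k, ‖B k l‖ ^ 2 := fun l =>
    Finset.single_le_sum (f := fun l => ∑ k, ‖B k l‖ ^ 2)
      (fun l _ => Finset.sum_nonneg fun k _ => sq_nonneg _) (Finset.mem_univ l)
  have ht : (Bᴴ * B).trace.re = ∑ l, ∑ k, ‖B k l‖ ^ 2 := by
    simp only [Matrix.trace, Matrix.diag_apply, Matrix.mul_apply, Matrix.conjTranspose_apply,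
      Complex.re_sum]
    refine Finset.sum_congr rfl fun l _ => Finset.sum_congr rfl fun k _ => ?_
    rw [RCLike.star_def, ← Complex.normSq_eq_conj_mul_self, Complex.normSq_eq_norm_sq,
      Complex.ofReal_re]
  rw [ht, Matrix.mul_apply]
  calc ‖∑ k, Bᴴ i k * B k j‖ ≤ ∑ k, ‖B k i‖ * ‖B k j‖ := by
        refine (norm_sum_le _ _).trans (le_of_eq ?_)
        refine Finset.sum_congr rfl fun k _ => ?_
        rw [Matrix.conjTranspose_apply, norm_mul, norm_star]
    _ ≤ ∑ k, (‖B k i‖ ^ 2 + ‖B k j‖ ^ 2) / 2 := by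
        refine Finset.sum_le_sum fun k _ => ?_
        nlinarith [sq_nonneg (‖B k i‖ - ‖B k j‖)]
    _ = ((∑ k, ‖B k i‖ ^ 2) + ∑ k, ‖B k j‖ ^ 2) / 2 := by
        rw [← Finset.sum_div, Finset.sum_add_distrib]
    _ ≤ _ := by linarith [hs i, hs j]

theorem span_posSemidef {ι : Type} [Fintype ι] [DecidableEq ι] :
    Submodule.span ℂ {A : Op ι | A.PosSemidef} = ⊤ := by
  open scoped Matrix.Norms.L2Operator in
  have h := CStarAlgebra.span_nonneg (A := Op ι)
  simpa only [Matrix.nonneg_iff_posSemidef] using h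

theorem PMF_summable_toReal (p : PMF ℕ) : Summable fun i => (p i).toReal :=
  ENNReal.summable_toReal p.tsum_coe_ne_top

theorem PMF_tsum_toReal (p : PMF ℕ) : ∑' i, (p i).toReal = 1 := by
  rw [← ENNReal.tsum_toReal_eq fun i => p.apply_ne_top i, p.tsum_coe, ENNReal.toReal_one]

theorem posSemidef_of_hasSum {ι : Type} [Fintype ι] {A : ℕ → Op ι} {B : Op ι}
    (h : HasSum A B) (hA : ∀ i, (A i).PosSemidef) : B.PosSemidef := by
  refine Matrix.PosSemidef.of_dotProduct_mulVec_nonneg ?_ fun x => ?_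
  · refine HasSum.unique h.matrix_conjTranspose ?_
    simpa only [(hA _).1.eq] using h
  · let φ : Op ι →+ ℂ := ⟨⟨fun M => star x ⬝ᵥ (M *ᵥ x), by simp⟩, fun M N => by
      simp [Matrix.add_mulVec, dotProduct_add]⟩
    have hφ : Continuous φ := by
      change Continuous fun M : Op ι => star x ⬝ᵥ (M *ᵥ x)
      fun_prop
    exact (h.map φ hφ).nonneg fun i => (hA i).dotProduct_mulVec_nonneg x

/-- The joint induction behind the facts below. -/
theorem AdaptiveCircuit.run_aux (c : AdaptiveCircuit Q) :
    (∀ ρ σ, c.run (ρ + σ) = c.run ρ + c.run σ) ∧ (∀ (z : ℂ) ρ, c.run (z • ρ) = z • c.run ρ) ∧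
      ∀ ρ, ρ.PosSemidef → (c.run ρ).PosSemidef ∧ (c.run ρ).trace = ρ.trace := by
  induction c with
  | halt => exact ⟨fun _ _ => rfl, fun _ _ => rfl, fun ρ h => ⟨h, rfl⟩⟩
  | clifford C hC next ih =>
    obtain ⟨h1, h2, h3⟩ := ih
    refine ⟨fun ρ σ => ?_, fun z ρ => ?_, fun ρ h => ?_⟩
    · simp only [run, map_add, h1]
    · simp only [run, map_smul, h2]
    · obtain ⟨h4, h5⟩ := h3 _ (h.mul_mul_conjTranspose_same C)
      exact ⟨h4, h5.trans (trace_conjMap_unitary (Matrix.mem_unitaryGroup_iff'.mp hC.1) ρ)⟩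
  | t q next ih =>
    obtain ⟨h1, h2, h3⟩ := ih
    refine ⟨fun ρ σ => ?_, fun z ρ => ?_, fun ρ h => ?_⟩
    · simp only [run, map_add, h1]
    · simp only [run, map_smul, h2]
    · obtain ⟨h4, h5⟩ := h3 _ (h.mul_mul_conjTranspose_same (tGate q))
      exact ⟨h4, h5.trans (trace_conjMap_unitary (tGate_unitary q) ρ)⟩
  | measure q next ih =>
    refine ⟨fun ρ σ => ?_, fun z ρ => ?_, fun ρ h => ?_⟩
    · simp only [run, map_add, (ih _).1, Finset.sum_add_distrib]
    · simp only [run, map_smul, (ih _).2.1, Finset.smul_sum]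
    · have h4 := fun b => (ih b).2.2 _ (h.mul_mul_conjTranspose_same (measProj q b))
      refine ⟨Matrix.posSemidef_sum _ fun b _ => (h4 b).1, ?_⟩
      simp only [run, Matrix.trace_sum]
      rw [← trace_conjMap_measProj q ρ]
      exact Finset.sum_congr rfl fun b _ => (h4 b).2
  | random p next ih =>
    have hp : ∀ ρ : Op (Q → Bool), ρ.PosSemidef →
        Summable fun i => ((p i).toReal : ℂ) • (next i).run ρ := by
      intro ρ h
      refine Pi.summable.mpr fun x => Pi.summable.mpr fun y => ?_
      refine Summable.of_norm_bounded ((PMF_summable_toReal p).mul_right ρ.trace.re) fun i => ?_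
      obtain ⟨h4, h5⟩ := (ih i).2.2 ρ h
      rw [Matrix.smul_apply, norm_smul, Complex.norm_real, Real.norm_of_nonneg
        ENNReal.toReal_nonneg, ← h5]
      exact mul_le_mul_of_nonneg_left (norm_apply_le_trace h4 x y) ENNReal.toReal_nonneg
    have hs : ∀ ρ : Op (Q → Bool),
        Summable fun i => ((p i).toReal : ℂ) • (next i).run ρ := by
      intro ρ
      have hρ : ρ ∈ Submodule.span ℂ {A : Op (Q → Bool) | A.PosSemidef} := by
        rw [span_posSemidef]; trivial
      induction hρ using Submodule.span_induction with
      | mem ρ h => exact hp ρ h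
      | zero =>
        refine hp 0 Matrix.PosSemidef.zero
      | add ρ σ _ _ h4 h5 =>
        simpa only [(ih _).1, smul_add] using h4.add h5
      | smul z ρ _ h4 =>
        simpa only [(ih _).2.1, smul_comm z] using h4.const_smul z
    refine ⟨fun ρ σ => ?_, fun z ρ => ?_, fun ρ h => ?_⟩
    · simp only [run, (ih _).1, smul_add]
      exact (hs ρ).tsum_add (hs σ)
    · simp only [run, (ih _).2.1, smul_comm _ z]
      exact (hs ρ).tsum_const_smul z
    · have h4 := fun i => (ih i).2.2 ρ h
      have h5 := (hs ρ).hasSum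
      refine ⟨posSemidef_of_hasSum h5 fun i => (h4 i).1.smul ?_, ?_⟩
      · exact Complex.zero_le_real.mpr ENNReal.toReal_nonneg
      · have h6 := h5.map (Matrix.traceAddMonoidHom (Q → Bool) ℂ) continuous_id.matrix_trace
        have h7 : ∀ i, ((p i).toReal • (next i).run ρ : Op (Q → Bool)).trace =
            ((p i).toReal : ℂ) * ρ.trace := fun i => by
          rw [Matrix.trace_smul, (h4 i).2, Complex.real_smul]
        have h8 : HasSum (fun i => ((p i).toReal : ℂ) * ρ.trace) (1 * ρ.trace) := by
          refine HasSum.mul_right _ ?_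
          have h9 := (PMF_summable_toReal p).hasSum
          rw [PMF_tsum_toReal] at h9
          exact Complex.ofReal_one ▸ Complex.hasSum_ofReal.mpr h9
        rw [one_mul] at h8
        refine HasSum.unique h6 ?_
        convert h8 using 2 with i
        exact h7 i

theorem AdaptiveCircuit.run_posSemidef (c : AdaptiveCircuit Q) {ρ : Op (Q → Bool)}
    (h : ρ.PosSemidef) : (c.run ρ).PosSemidef :=
  (c.run_aux.2.2 ρ h).1

theorem AdaptiveCircuit.trace_run (c : AdaptiveCircuit Q) {ρ : Op (Q → Bool)}
    (h : ρ.PosSemidef) : (c.run ρ).trace = ρ.trace :=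
  (c.run_aux.2.2 ρ h).2

/-- The map `AdaptiveCircuit.run` as a linear map. -/
def AdaptiveCircuit.runLin (c : AdaptiveCircuit Q) : Op (Q → Bool) →ₗ[ℂ] Op (Q → Bool) where
  toFun := c.run
  map_add' := c.run_aux.1
  map_smul' := c.run_aux.2.1

end Linearity

/-! ### Ancillas, channels, the adaptive `T`-count -/

section Count

variable {Q : Type} [Fintype Q] [DecidableEq Q]

/-- Adjoining `a` ancilla qubits in the all-zeros state: the map `ρ ↦ ρ ⊗ |0ᵃ⟩⟨0ᵃ|`. -/
def withAncilla (a : ℕ) : Op (Q → Bool) →ₗ[ℂ] Op (Q ⊕ Fin a → Bool) where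
  toFun ρ := Matrix.of fun x y =>
    if (∀ i, x (Sum.inr i) = false) ∧ (∀ i, y (Sum.inr i) = false) then
      ρ (fun q => x (Sum.inl q)) (fun q => y (Sum.inl q)) else 0
  map_add' ρ σ := by
    ext x y
    simp only [Matrix.of_apply, Matrix.add_apply]
    split_ifs <;> simp
  map_smul' z ρ := by
    ext x y
    simp only [Matrix.of_apply, Matrix.smul_apply, RingHom.id_apply]
    split_ifs <;> simp

/-- Discarding the `a` ancilla qubits: the partial trace over them. -/
def traceAncilla (a : ℕ) : Op (Q ⊕ Fin a → Bool) →ₗ[ℂ] Op (Q → Bool) where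
  toFun ρ := Matrix.of fun x y => ∑ z : Fin a → Bool, ρ (Sum.elim x z) (Sum.elim y z)
  map_add' ρ σ := by
    ext x y
    simp [Finset.sum_add_distrib]
  map_smul' c ρ := by
    ext x y
    simp [Finset.mul_sum]

/-- The channel on the register `Q` defined by an adaptive circuit with `a` ancilla qubits. -/
def AdaptiveCircuit.channel {a : ℕ} (c : AdaptiveCircuit (Q ⊕ Fin a)) :
    Op (Q → Bool) →ₗ[ℂ] Op (Q → Bool) :=
  traceAncilla a ∘ₗ c.runLin ∘ₗ withAncilla a

/-- The supremum over the pure input states `ψ` of the register `Q` of the expected number of `T`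
gates that the circuit applies on input `ψ`. -/
def AdaptiveCircuit.worstCaseT {a : ℕ} (c : AdaptiveCircuit (Q ⊕ Fin a)) : ℝ≥0∞ :=
  ⨆ (ψ : (Q → Bool) → ℂ) (_ : IsPure ψ), c.expectedT (withAncilla a (ketbra ψ))

/-- The `ε`-approximate adaptive `T`-count of the unitary `U`: the infimum of the worst-case
expected numbers of `T` gates of the adaptive Clifford+`T` circuits, with any number `a` of
ancilla qubits, whose channel is within `ε` of `ρ ↦ U ρ U†` in diamond distance. -/
def adaptiveTCount (ε : ℝ≥0) (U : Op (Q → Bool)) : ℝ≥0∞ :=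
  ⨅ (a : ℕ) (c : AdaptiveCircuit (Q ⊕ Fin a)) (_ : diamondDist c.channel (conjMap U) ≤ ε),
    c.worstCaseT

end Count

/-! ### Boolean functions -/

/-- The unitary `U_f` on `n + 1` qubits with `U_f |x⟩|b⟩ = |x⟩|b ⊕ f(x)⟩` for all `n`-bit
strings `x` and all bits `b`; the last qubit is the one that holds `b`. -/
def oracle {n : ℕ} (f : (Fin n → Bool) → Bool) : Op (Fin (n + 1) → Bool) :=
  Matrix.of fun y x =>
    if y = Fin.snoc (Fin.init x) (xor (x (Fin.last n)) (f (Fin.init x))) then 1 else 0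

/-- The parity `XOR_S(x)` of the bits `x i` with `i ∈ S`: it is `1` if and only if an odd number
of these bits is `1`. -/
def xorOn {n : ℕ} (S : Finset (Fin n)) (x : Fin n → Bool) : Bool :=
  decide (Odd (S.filter fun i => x i = true).card)

/-- `f` is computed by a non-adaptive parity decision tree of depth `k`: it is a function of `k`
parities of its input bits. -/
def ComputedByPDT {n : ℕ} (f : (Fin n → Bool) → Bool) (k : ℕ) : Prop :=
  ∃ (S : Fin k → Finset (Fin n)) (g : (Fin k → Bool) → Bool),
    ∀ x, f x = g fun j => xorOn (S j) x

theorem computedByPDT_self {n : ℕ} (f : (Fin n → Bool) → Bool) : ComputedByPDT f n :=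
  ⟨fun j => {j}, f, fun x => by
    congr 1
    ext j
    cases h : x j <;> simp [xorOn, Finset.filter_singleton, h]⟩

/-- The non-adaptive parity decision tree complexity of `f`: the least depth of a non-adaptive
parity decision tree that computes `f` (such a depth exists by `computedByPDT_self`). -/
def pdt {n : ℕ} (f : (Fin n → Bool) → Bool) : ℕ :=
  sInf {k | ComputedByPDT f k}

end

end CliffordT

/-!
The proof counts, for a vector `ψ`, the Pauli operators (without their phases) of which `ψ` is an
eigenvector: the set `stab ψ`. On `N` qubits a product of states `|0⟩` and `|+⟩` has at least `2 ^ N`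
of them. Clifford unitaries permute the Pauli operators (`card_stab_le_clifford`), a `T` gate
preserves at least the half that commutes with `Z` on its qubit (`card_stab_le_two_mul_diagonal`),
and postselecting on a measurement outcome loses nothing, because the `Z` of the measured qubit
makes up for the operators that anticommute with it (`card_stab_le_project`).

Run a circuit for `U_f` on the input `|+ⁿ⟩|0⟩`. Some branch of positive probability applies at most
as many `T` gates as are expected, say `k` (`AdaptiveCircuit.exists_branch`). The channel of the
circuit is exactly `U_f`, so this branch ends in the product of the state `∑ u, |u⟩|f u⟩`
with some state of the ancillas (`exists_slice_eq_smul`). Postselecting the `a` ancillas on a basis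
state shows that they account for a factor of at most `2 ^ a` (`card_stab_le_of_slices`). So
`∑ u, |u⟩|f u⟩` has a stabilizer of at least `2 ^ (n + 1 - k)` elements.

On the other hand, if an operator `Z ^ (b, d) X ^ (a, c)` stabilizes `∑ u, |u⟩|f u⟩`, then
`f (u + a) = f u + c` and `b · u + d * f u` is constant. If `d = 1` ever occurs, then `f` is affine
and one parity computes it. Otherwise `b = 0`, and the stabilizer is at most twice as large as the
group of periods of `f` (`pdt_le_one_or_card_stab_le`). Hence `f` has at least `2 ^ (n - k)`
periods, and it is a function of the `k` linear forms that cut them out (`pdt_le_of_card_periods`).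
-/

namespace CliffordT

open Matrix
open scoped ComplexOrder MatrixOrder ENNReal NNReal symmDiff

/-! ### Pauli operators in binary form -/

section Pauli

variable {Q : Type} [Fintype Q]

/-- The sign `(-1) ^ (z · y)`. -/
def sgn (z y : Q → Bool) : ℂ := ∏ q, if z q && y q then -1 else 1

theorem sgn_mul_self (z y : Q → Bool) : sgn z y * sgn z y = 1 := by
  rw [sgn, ← Finset.prod_mul_distrib]
  exact Finset.prod_eq_one fun q _ => by split_ifs <;> norm_num

theorem sgn_ne_zero (z y : Q → Bool) : sgn z y ≠ 0 := fun h => by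
  simpa [h] using sgn_mul_self z y

theorem sgn_symmDiff_right (z x y : Q → Bool) : sgn z (x ∆ y) = sgn z x * sgn z y := by
  rw [sgn, sgn, sgn, ← Finset.prod_mul_distrib]
  refine Finset.prod_congr rfl fun q _ => ?_
  rw [Pi.symmDiff_apply]
  cases z q <;> cases x q <;> cases y q <;> simp

theorem sgn_symmDiff_left (x y z : Q → Bool) : sgn (x ∆ y) z = sgn x z * sgn y z := by
  rw [sgn, sgn, sgn, ← Finset.prod_mul_distrib]
  refine Finset.prod_congr rfl fun q _ => ?_
  rw [Pi.symmDiff_apply]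
  cases z q <;> cases x q <;> cases y q <;> simp

theorem sgn_bot_right (z : Q → Bool) : sgn z ⊥ = 1 := by simp [sgn]

theorem sgn_single_right [DecidableEq Q] (z : Q → Bool) (q : Q) :
    sgn z (Function.update ⊥ q true) = if z q then -1 else 1 := by
  rw [sgn, Finset.prod_eq_single q]
  · simp
  · intro r _ hr
    simp [Function.update_of_ne hr]
  · simp

theorem sgn_comm (z y : Q → Bool) : sgn z y = sgn y z := by
  simp only [sgn, Bool.and_comm]

theorem sgn_single_left [DecidableEq Q] (y : Q → Bool) (q : Q) :
    sgn (Function.update ⊥ q true) y = if y q then -1 else 1 := by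
  rw [sgn_comm, sgn_single_right]

/-- The single-qubit operator `Z ^ b * X ^ a`. -/
def weylBit (a b : Bool) : Op Bool :=
  Matrix.of fun u v => if v = u ∆ a then (if b && u then -1 else 1) else 0

/-- The Pauli operator `⨂ q, Z ^ (p.2 q) * X ^ (p.1 q)`. Up to a phase, these are all the elements
of the Pauli group, so that a pair of bit strings encodes a Pauli operator without its phase. -/
def weyl (p : (Q → Bool) × (Q → Bool)) : Op (Q → Bool) :=
  tensor fun q => weylBit (p.1 q) (p.2 q)

theorem weyl_apply (p : (Q → Bool) × (Q → Bool)) (y y' : Q → Bool) :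
    weyl p y y' = if y' = y ∆ p.1 then sgn p.2 y else 0 := by
  simp only [weyl, tensor, weylBit, Matrix.of_apply]
  split_ifs with h
  · subst h
    refine Finset.prod_congr rfl fun q _ => ?_
    rw [if_pos (Pi.symmDiff_apply ..)]
  · obtain ⟨q, hq⟩ := Function.ne_iff.mp h
    exact Finset.prod_eq_zero (Finset.mem_univ q) (if_neg hq)

theorem weyl_mulVec [DecidableEq Q] (p : (Q → Bool) × (Q → Bool)) (ψ : (Q → Bool) → ℂ)
    (y : Q → Bool) :
    (weyl p *ᵥ ψ) y = sgn p.2 y * ψ (y ∆ p.1) := by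
  simp [mulVec, dotProduct, weyl_apply]

theorem weyl_injective_of_smul [DecidableEq Q] {p p' : (Q → Bool) × (Q → Bool)} {c : ℂ}
    (h : weyl p = c • weyl p') : p = p' := by
  have h0 : ∀ y y', (if y' = y ∆ p.1 then sgn p.2 y else 0) =
      c * if y' = y ∆ p'.1 then sgn p'.2 y else 0 := fun y y' => by
    rw [← weyl_apply, ← weyl_apply, h, Matrix.smul_apply, smul_eq_mul]
  have h1 : p.1 = p'.1 := by
    by_contra hne
    have h2 := h0 ⊥ (⊥ ∆ p.1)
    rw [if_pos rfl, if_neg (by simpa using hne), mul_zero] at h2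
    exact sgn_ne_zero _ _ h2
  have h2 : ∀ y, sgn p.2 y = c * sgn p'.2 y := fun y => by
    have h3 := h0 y (y ∆ p.1)
    rwa [if_pos rfl, if_pos (by rw [h1])] at h3
  have hc : c = 1 := by simpa [sgn_bot_right] using (h2 ⊥).symm
  refine Prod.ext h1 (funext fun q => ?_)
  have h3 := h2 (Function.update ⊥ q true)
  rw [sgn_single_right, sgn_single_right, hc, one_mul] at h3
  cases h4 : p.2 q <;> cases h5 : p'.2 q <;> rw [h4, h5] at h3 <;> norm_num at h3

theorem tensor_smul (c : Q → ℂ) (A : Q → Op Bool) :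
    tensor (fun q => c q • A q) = (∏ q, c q) • tensor A := by
  ext x y
  simp [tensor, Finset.prod_mul_distrib]

theorem weyl_mem_pauliGroup (p : (Q → Bool) × (Q → Bool)) : weyl p ∈ pauliGroup Q := by
  have h : ∀ a b, ∃ (k : ℕ) (P : Op Bool),
      (P = 1 ∨ P = pauliX ∨ P = pauliY ∨ P = pauliZ) ∧ weylBit a b = Complex.I ^ k • P := by
    intro a b
    cases a <;> cases b
    · refine ⟨0, 1, by simp, ?_⟩
      ext u v; cases u <;> cases v <;> simp [weylBit]
    · refine ⟨0, pauliZ, by simp, ?_⟩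
      ext u v; cases u <;> cases v <;> simp [weylBit, pauliZ]
    · refine ⟨0, pauliX, by simp, ?_⟩
      ext u v; cases u <;> cases v <;> simp [weylBit, pauliX]
    · refine ⟨1, pauliY, by simp, ?_⟩
      ext u v
      cases u <;> cases v <;> simp [weylBit, pauliY, pauliX, pauliZ]
  choose k P hP hW using fun q => h (p.1 q) (p.2 q)
  refine ⟨∑ q, k q, P, hP, ?_⟩
  rw [weyl, funext hW, tensor_smul, Finset.prod_pow_eq_pow_sum]

theorem exists_weyl_of_mem_pauliGroup {M : Op (Q → Bool)} (hM : M ∈ pauliGroup Q) :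
    ∃ (c : ℂ) (p : (Q → Bool) × (Q → Bool)), c ≠ 0 ∧ M = c • weyl p := by
  obtain ⟨k, P, hP, rfl⟩ := hM
  have h : ∀ q, ∃ (j : ℕ) (a b : Bool), P q = Complex.I ^ j • weylBit a b := by
    intro q
    rcases hP q with h | h | h | h <;> rw [h]
    · refine ⟨0, false, false, ?_⟩
      ext u v; cases u <;> cases v <;> simp [weylBit]
    · refine ⟨0, true, false, ?_⟩
      ext u v; cases u <;> cases v <;> simp [weylBit, pauliX]
    · refine ⟨3, true, true, ?_⟩
      ext u v
      cases u <;> cases v <;> simp [weylBit, pauliY, pauliX, pauliZ]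
    · refine ⟨0, false, true, ?_⟩
      ext u v; cases u <;> cases v <;> simp [weylBit, pauliZ]
  choose j a b hW using h
  refine ⟨Complex.I ^ k * Complex.I ^ (∑ q, j q), (a, b), by simp, ?_⟩
  rw [funext hW, tensor_smul, Finset.prod_pow_eq_pow_sum, smul_smul, weyl]

theorem apply_symmDiff_ne_zero {ψ : (Q → Bool) → ℂ} (hψ : ψ ≠ 0) {p : (Q → Bool) × (Q → Bool)}
    {c : ℂ} (hc : ∀ y, sgn p.2 y * ψ (y ∆ p.1) = c * ψ y) {y : Q → Bool} (hy : ψ y ≠ 0) :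
    ψ (y ∆ p.1) ≠ 0 := by
  obtain ⟨y₀, h₀⟩ := Function.ne_iff.mp hψ
  have h1 := hc (y₀ ∆ p.1)
  rw [symmDiff_symmDiff_cancel_right] at h1
  have hc0 : c ≠ 0 := by
    rintro rfl
    rw [zero_mul] at h1
    exact mul_ne_zero (sgn_ne_zero _ _) h₀ h1
  intro h2
  have h3 := hc y
  rw [h2, mul_zero] at h3
  exact mul_ne_zero hc0 hy h3.symm

end Pauli

/-! ### The Pauli operators that stabilize a vector up to a phase -/

section Stab

variable {Q : Type} [Fintype Q] [DecidableEq Q]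

open Classical in
/-- The Pauli operators, without their phases, of which `ψ` is an eigenvector. For `ψ ≠ 0` they
are a commuting group; the ratio `2 ^ |Q| / #(stab ψ)` measures how far `ψ` is from being a
stabilizer state. -/
noncomputable def stab (ψ : (Q → Bool) → ℂ) : Finset ((Q → Bool) × (Q → Bool)) :=
  Finset.univ.filter fun p => ∃ c : ℂ, ∀ y, sgn p.2 y * ψ (y ∆ p.1) = c * ψ y

theorem mem_stab {ψ : (Q → Bool) → ℂ} {p : (Q → Bool) × (Q → Bool)} :
    p ∈ stab ψ ↔ ∃ c : ℂ, ∀ y, sgn p.2 y * ψ (y ∆ p.1) = c * ψ y := by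
  simp [stab]

theorem mem_stab_iff_weyl {ψ : (Q → Bool) → ℂ} {p : (Q → Bool) × (Q → Bool)} :
    p ∈ stab ψ ↔ ∃ c : ℂ, weyl p *ᵥ ψ = c • ψ := by
  simp only [mem_stab, funext_iff, weyl_mulVec, Pi.smul_apply, smul_eq_mul]

theorem symmDiff_mem_stab {ψ : (Q → Bool) → ℂ} {p p' : (Q → Bool) × (Q → Bool)}
    (hp : p ∈ stab ψ) (hp' : p' ∈ stab ψ) : p ∆ p' ∈ stab ψ := by
  obtain ⟨c, hc⟩ := mem_stab.mp hp
  obtain ⟨c', hc'⟩ := mem_stab.mp hp'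
  refine mem_stab.mpr ⟨c' * sgn p'.2 p.1 * c, fun y => ?_⟩
  have h1 := hc' (y ∆ p.1)
  rw [sgn_symmDiff_right] at h1
  change sgn (p.2 ∆ p'.2) y * ψ (y ∆ (p.1 ∆ p'.1)) = _
  rw [sgn_symmDiff_left, ← symmDiff_assoc]
  linear_combination (sgn p.2 y * sgn p'.2 p.1) * h1 +
    (c' * sgn p'.2 p.1) * hc y - (sgn p.2 y * sgn p'.2 y * ψ (y ∆ p.1 ∆ p'.1)) *
      sgn_mul_self p'.2 p.1

/-- A vector stabilized by an operator that anticommutes with `Z` on qubit `q` is not an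
eigenvector of the latter. -/
theorem single_notMem_stab {ψ : (Q → Bool) → ℂ} (hψ : ψ ≠ 0) {p : (Q → Bool) × (Q → Bool)}
    (hp : p ∈ stab ψ) {q : Q} (hq : p.1 q = true) :
    ((⊥, Function.update ⊥ q true) : (Q → Bool) × (Q → Bool)) ∉ stab ψ := by
  intro h
  obtain ⟨d, hd⟩ := mem_stab.mp h
  obtain ⟨c, hc⟩ := mem_stab.mp hp
  obtain ⟨y, hy⟩ := Function.ne_iff.mp hψ
  have h1 := hd y
  have h2 := hd (y ∆ p.1)
  simp only [symmDiff_bot, sgn_single_left] at h1 h2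
  have h3 := mul_right_cancel₀ hy h1
  have h4 := mul_right_cancel₀ (apply_symmDiff_ne_zero hψ hc hy) h2
  rw [← h3, Pi.symmDiff_apply, hq] at h4
  cases h5 : y q <;> rw [h5] at h4 <;> norm_num at h4

theorem mem_stab_diagonal {ψ : (Q → Bool) → ℂ} (D : Bool → ℂ) {p : (Q → Bool) × (Q → Bool)}
    (hp : p ∈ stab ψ) {q : Q} (hq : p.1 q = false) : p ∈ stab fun y => D (y q) * ψ y := by
  obtain ⟨c, hc⟩ := mem_stab.mp hp
  refine mem_stab.mpr ⟨c, fun y => ?_⟩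
  have h : (y ∆ p.1) q = y q := by
    rw [Pi.symmDiff_apply, hq]
    simp
  rw [h]
  linear_combination D (y q) * hc y

/-- At least half of the operators in the stabilizer commute with `Z` on a given qubit, since an
operator that does not commute with it maps the others of this kind to ones that do. -/
theorem card_stab_le_two_mul_filter (ψ : (Q → Bool) → ℂ) (q : Q) :
    (stab ψ).card ≤ 2 * ((stab ψ).filter fun p => p.1 q = false).card := by
  have hT : ((stab ψ).filter fun p => ¬ p.1 q = false).card ≤
      ((stab ψ).filter fun p => p.1 q = false).card := by
    rcases ((stab ψ).filter fun p => ¬ p.1 q = false).eq_empty_or_nonempty with h | ⟨p₀, h₀⟩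
    · rw [h, Finset.card_empty]
      exact Nat.zero_le _
    · rw [Finset.mem_filter] at h₀
      refine Finset.card_le_card_of_injOn (fun p => p ∆ p₀) (fun p hp => ?_) ?_
      · rw [Finset.mem_coe, Finset.mem_filter] at hp ⊢
        refine ⟨symmDiff_mem_stab hp.1 h₀.1, ?_⟩
        change (p.1 ∆ p₀.1) q = false
        rw [Pi.symmDiff_apply]
        have h1 := hp.2
        have h2 := h₀.2
        simp only [Bool.not_eq_false] at h1 h2
        simp [h1, h2]
      · exact fun p _ p' _ h => symmDiff_left_injective p₀ h
  rw [← Finset.card_filter_add_card_filter_not (s := stab ψ) (fun p => p.1 q = false)]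
  omega

/-- A gate that is diagonal on one qubit at most halves the stabilizer. -/
theorem card_stab_le_two_mul_diagonal (ψ : (Q → Bool) → ℂ) (D : Bool → ℂ) (q : Q) :
    (stab ψ).card ≤ 2 * (stab fun y => D (y q) * ψ y).card := by
  refine (card_stab_le_two_mul_filter ψ q).trans (Nat.mul_le_mul_left 2 ?_)
  refine Finset.card_le_card fun p hp => ?_
  rw [Finset.mem_filter] at hp
  exact mem_stab_diagonal D hp.1 hp.2

/-- Postselecting on a possible outcome of a measurement does not shrink the stabilizer: if half
of the operators are lost, then `Z` on the measured qubit is new. -/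
theorem card_stab_le_project {ψ : (Q → Bool) → ℂ} (hψ : ψ ≠ 0) (q : Q) (b : Bool) :
    (stab ψ).card ≤ (stab fun y => (if y q = b then 1 else 0) * ψ y).card := by
  set ψ' : (Q → Bool) → ℂ := fun y => (if y q = b then 1 else 0) * ψ y with hψ'
  have hold : ∀ p ∈ stab ψ, p.1 q = false → p ∈ stab ψ' := fun p hp hq =>
    mem_stab_diagonal (fun u => if u = b then 1 else 0) hp hq
  by_cases hT : ∃ p ∈ stab ψ, p.1 q = true
  swap
  · refine Finset.card_le_card fun p hp => hold p hp ?_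
    by_contra h
    exact hT ⟨p, hp, by simpa using h⟩
  obtain ⟨p₀, hp₀, hq₀⟩ := hT
  set e : (Q → Bool) × (Q → Bool) := (⊥, Function.update ⊥ q true) with he
  have hne : e ∉ stab ψ := single_notMem_stab hψ hp₀ hq₀
  have hnew : e ∈ stab ψ' := by
    refine mem_stab.mpr ⟨if b then -1 else 1, fun y => ?_⟩
    simp only [he, hψ', symmDiff_bot, sgn_single_left]
    by_cases h : y q = b
    · simp [h]
    · simp [h]
  refine Finset.card_le_card_of_injOn
    (fun p => if p.1 q = false then p else (p ∆ p₀) ∆ e) (fun p hp => ?_) ?_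
  · rw [Finset.mem_coe] at hp ⊢
    dsimp only
    split_ifs with h
    · exact hold p hp h
    · refine symmDiff_mem_stab (hold _ (symmDiff_mem_stab hp hp₀) ?_) hnew
      change (p.1 ∆ p₀.1) q = false
      rw [Pi.symmDiff_apply, hq₀, Bool.eq_true_of_not_eq_false h]
      simp
  · have hmix : ∀ p ∈ stab ψ, ∀ p' ∈ stab ψ, p ≠ (p' ∆ p₀) ∆ e := by
      rintro p hp p' hp' h
      refine hne ?_
      have h1 : e = (p' ∆ p₀) ∆ p := by rw [h, symmDiff_symmDiff_cancel_left]
      rw [h1]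
      exact symmDiff_mem_stab (symmDiff_mem_stab hp' hp₀) hp
    intro p hp p' hp' h
    dsimp only at h
    split_ifs at h
    · exact h
    · exact absurd h (hmix p hp p' hp')
    · exact absurd h.symm (hmix p' hp' p hp)
    · exact symmDiff_left_injective p₀ (symmDiff_left_injective e h)

theorem card_stab_le_clifford {C : Op (Q → Bool)} (hC : IsClifford C) (ψ : (Q → Bool) → ℂ) :
    (stab ψ).card ≤ (stab (C *ᵥ ψ)).card := by
  have hCC : Cᴴ * C = 1 := Matrix.mem_unitaryGroup_iff'.mp hC.1
  choose c g hc hg using fun p =>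
    exists_weyl_of_mem_pauliGroup (hC.2 _ (weyl_mem_pauliGroup p))
  refine Finset.card_le_card_of_injOn g (fun p hp => ?_) fun p _ p' _ h => ?_
  · rw [Finset.mem_coe, mem_stab_iff_weyl] at hp ⊢
    obtain ⟨d, hd⟩ := hp
    refine ⟨(c p)⁻¹ * d, ?_⟩
    have h1 : weyl (g p) = (c p)⁻¹ • (C * weyl p * Cᴴ) := by
      rw [hg, smul_smul, inv_mul_cancel₀ (hc p), one_smul]
    rw [h1, smul_mulVec, mulVec_mulVec, Matrix.mul_assoc, hCC, Matrix.mul_one,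
      ← mulVec_mulVec, hd, mulVec_smul, smul_smul]
  · have h1 : ∀ p, weyl p = c p • (Cᴴ * weyl (g p) * C) := fun p => by
      have h2 := congrArg (fun M => Cᴴ * M * C) (hg p)
      simp only [Matrix.mul_smul, Matrix.smul_mul] at h2
      rw [← h2]
      calc weyl p = (Cᴴ * C) * weyl p * (Cᴴ * C) := by rw [hCC, Matrix.one_mul, Matrix.mul_one]
        _ = _ := by simp only [Matrix.mul_assoc]
    refine weyl_injective_of_smul (c := c p * (c p')⁻¹) ?_
    rw [h1 p, h1 p', h, smul_smul, inv_mul_cancel_right₀ (hc p')]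

/-- The product of states `|0⟩` on the qubits in `A` and `|+⟩` on the others, with all nonzero
amplitudes equal to `r`. -/
def plusZero (A : Q → Prop) [DecidablePred A] (r : ℂ) (y : Q → Bool) : ℂ :=
  if ∀ q, A q → y q = false then r else 0

theorem two_pow_card_le_card_stab (A : Q → Prop) [DecidablePred A] (r : ℂ) :
    2 ^ Fintype.card Q ≤
      (stab (plusZero A r)).card := by
  have h : 2 ^ Fintype.card Q = (Finset.univ : Finset (Q → Bool)).card := by simp
  rw [h]
  refine Finset.card_le_card_of_injOn
    (fun w => (fun q => if A q then false else w q, fun q => if A q then w q else false))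
    (fun w _ => ?_) fun w _ w' _ h => ?_
  · rw [Finset.mem_coe, mem_stab]
    refine ⟨1, fun y => ?_⟩
    have h1 : (∀ q, A q → (y ∆ fun q => if A q then false else w q) q = false) ↔
        ∀ q, A q → y q = false := by
      refine forall₂_congr fun q hq => ?_
      rw [Pi.symmDiff_apply]
      simp [hq]
    simp only [plusZero, h1]
    split_ifs with h2
    · have h3 : sgn (fun q => if A q then w q else false) y = 1 := by
        refine Finset.prod_eq_one fun q _ => ?_
        by_cases hq : A q
        · simp [h2 q hq]
        · simp [hq]
      rw [h3]
    · simp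
  · funext q
    have h1 := congrFun (congrArg Prod.fst h) q
    have h2 := congrFun (congrArg Prod.snd h) q
    by_cases hq : A q <;> simp [hq] at h1 h2
    · exact h2
    · exact h1

/-- Postselecting on the values `z` of the qubits in `s` does not shrink the stabilizer. -/
theorem card_stab_le_project_finset {φ : (Q → Bool) → ℂ} {z : Q → Bool} (hz : φ z ≠ 0)
    (s : Finset Q) :
    (stab φ).card ≤ (stab fun y => if ∀ q ∈ s, y q = z q then φ y else 0).card := by
  induction s using Finset.induction_on with
  | empty => simp
  | insert q s _ ih =>
    refine ih.trans ?_
    have hne : (fun y => if ∀ q ∈ s, y q = z q then φ y else 0) ≠ 0 := fun h => by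
      have := congrFun h z
      simp [hz] at this
    refine (card_stab_le_project hne q (z q)).trans (le_of_eq ?_)
    congr 2
    funext y
    by_cases h1 : y q = z q <;> by_cases h2 : ∀ q ∈ s, y q = z q <;> simp [h1]

end Stab

/-! ### Branches of an adaptive circuit -/

section Branch

theorem conjMap_ketbra {ι : Type} [Fintype ι] (A : Op ι) (φ : ι → ℂ) :
    conjMap A (ketbra φ) = ketbra (A *ᵥ φ) := by
  change A * vecMulVec φ (star φ) * Aᴴ = vecMulVec (A *ᵥ φ) (star (A *ᵥ φ))
  rw [mul_vecMulVec, vecMulVec_mul, star_mulVec]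

theorem trace_ketbra {ι : Type} [Fintype ι] (φ : ι → ℂ) :
    (ketbra φ).trace = ((∑ y, ‖φ y‖ ^ 2 : ℝ) : ℂ) := by
  simp only [ketbra, Matrix.trace, Matrix.diag_apply, vecMulVec_apply, Pi.star_apply]
  push_cast
  refine Finset.sum_congr rfl fun y _ => ?_
  rw [RCLike.star_def, mul_comm, ← Complex.normSq_eq_conj_mul_self, Complex.normSq_eq_norm_sq]
  push_cast
  rfl

theorem trace_ketbra_re_nonneg {ι : Type} [Fintype ι] (φ : ι → ℂ) :
    0 ≤ (ketbra φ).trace.re := by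
  rw [trace_ketbra, Complex.ofReal_re]
  exact Finset.sum_nonneg fun _ _ => sq_nonneg _

theorem ketbra_trace_ne_zero {ι : Type} [Fintype ι] {φ : ι → ℂ} (hφ : φ ≠ 0) :
    (ketbra φ).trace ≠ 0 := by
  intro h
  rw [trace_ketbra, Complex.ofReal_eq_zero,
    Finset.sum_eq_zero_iff_of_nonneg fun _ _ => sq_nonneg _] at h
  exact hφ (funext fun y => by simpa using h y (Finset.mem_univ y))

theorem posSemidef_ketbra {ι : Type} [Fintype ι] (φ : ι → ℂ) : (ketbra φ).PosSemidef :=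
  posSemidef_vecMulVec_self_star φ

theorem star_dotProduct_ketbra_mulVec {ι : Type} [Fintype ι] (φ w : ι → ℂ) :
    star w ⬝ᵥ (ketbra φ *ᵥ w) = (star w ⬝ᵥ φ) * star (star w ⬝ᵥ φ) := by
  rw [ketbra, vecMulVec_mulVec, dotProduct_smul, ← star_dotProduct, op_smul_eq_mul]

variable {Q : Type} [Fintype Q] [DecidableEq Q]

theorem tGate_mulVec (q : Q) (φ : (Q → Bool) → ℂ) :
    tGate q *ᵥ φ = fun y =>
      (fun u : Bool => if u then Complex.exp (Complex.I * (Real.pi / 4)) else 1) (y q) * φ y := by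
  funext y
  rw [tGate_eq, mulVec_diagonal]

theorem measProj_mulVec (q : Q) (b : Bool) (φ : (Q → Bool) → ℂ) :
    measProj q b *ᵥ φ = fun y => (if y q = b then 1 else 0) * φ y := by
  funext y
  rw [measProj_eq, mulVec_diagonal]

theorem mulVec_ne_zero_of_conjTranspose_mul {ι : Type} [Fintype ι] [DecidableEq ι] {U : Op ι}
    (hU : Uᴴ * U = 1) {φ : ι → ℂ} (hφ : φ ≠ 0) : U *ᵥ φ ≠ 0 := fun h => hφ <| by
  rw [← one_mulVec φ, ← hU, ← mulVec_mulVec, h, mulVec_zero]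

/-- The series defining `AdaptiveCircuit.run` for a random choice converges. -/
theorem AdaptiveCircuit.summable_run (p : PMF ℕ) (next : ℕ → AdaptiveCircuit Q)
    {ρ : Op (Q → Bool)} (hρ : ρ.PosSemidef) (h0 : ρ.trace ≠ 0) :
    Summable fun i => ((p i).toReal : ℂ) • (next i).run ρ := by
  -- A divergent series would have the junk value `0`, but `run` preserves the trace.
  by_contra h
  refine h0 ?_
  rw [← (AdaptiveCircuit.random p next).trace_run hρ, AdaptiveCircuit.run,
    tsum_eq_zero_of_not_summable h, Matrix.trace_zero]

/-- A run of a circuit on a pure state `φ` has a branch, ending in a pure state `φ'`, that applies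
at most as many `T` gates as are expected. As `φ'` is a component of the final mixed state, it is
orthogonal to the kernel of the latter. Along the branch only the `T` gates shrink the stabilizer,
each by a factor of at most two. All states are unnormalized. -/
theorem AdaptiveCircuit.exists_branch (c : AdaptiveCircuit Q) :
    ∀ φ : (Q → Bool) → ℂ, φ ≠ 0 → ∃ (φ' : (Q → Bool) → ℂ) (j : ℕ), φ' ≠ 0 ∧
      (j : ℝ≥0∞) * ENNReal.ofReal (ketbra φ).trace.re ≤ c.expectedT (ketbra φ) ∧
      (stab φ).card ≤ 2 ^ j * (stab φ').card ∧
      ∀ w, star w ⬝ᵥ (c.run (ketbra φ) *ᵥ w) = 0 → star w ⬝ᵥ φ' = 0 := by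
  induction c with
  | halt =>
    intro φ hφ
    refine ⟨φ, 0, hφ, by simp, by simp, fun w hw => ?_⟩
    rw [run, star_dotProduct_ketbra_mulVec] at hw
    simpa using hw
  | clifford C hC next ih =>
    intro φ hφ
    have hU := Matrix.mem_unitaryGroup_iff'.mp hC.1
    obtain ⟨φ', j, h1, h2, h3, h4⟩ := ih (C *ᵥ φ) (mulVec_ne_zero_of_conjTranspose_mul hU hφ)
    rw [← conjMap_ketbra] at h2 h4
    rw [trace_conjMap_unitary hU] at h2
    exact ⟨φ', j, h1, h2, (card_stab_le_clifford hC φ).trans h3, h4⟩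
  | t q next ih =>
    intro φ hφ
    have hU := tGate_unitary q
    obtain ⟨φ', j, h1, h2, h3, h4⟩ := ih (tGate q *ᵥ φ)
      (mulVec_ne_zero_of_conjTranspose_mul hU hφ)
    rw [← conjMap_ketbra] at h2 h4
    rw [trace_conjMap_unitary hU] at h2
    refine ⟨φ', j + 1, h1, ?_, ?_, h4⟩
    · rw [expectedT, Nat.cast_add, Nat.cast_one, add_mul, one_mul, add_comm]
      exact add_le_add le_rfl h2
    · rw [tGate_mulVec] at h3
      have h5 := card_stab_le_two_mul_diagonal φ
        (fun u : Bool => if u then Complex.exp (Complex.I * (Real.pi / 4)) else 1) q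
      rw [pow_succ]
      linarith
  | measure q next ih =>
    intro φ hφ
    have htr : ∑ b, ENNReal.ofReal (ketbra (measProj q b *ᵥ φ)).trace.re =
        ENNReal.ofReal (ketbra φ).trace.re := by
      rw [← ENNReal.ofReal_sum_of_nonneg fun b _ => trace_ketbra_re_nonneg _, ← Complex.re_sum,
        ← trace_conjMap_measProj q (ketbra φ)]
      simp only [conjMap_ketbra]
    have hex : ∃ b, measProj q b *ᵥ φ ≠ 0 := by
      by_contra! h
      have h1 := trace_conjMap_measProj q (ketbra φ)
      simp only [conjMap_ketbra, h] at h1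
      rw [Finset.sum_eq_zero fun b _ => by simp [ketbra]] at h1
      exact ketbra_trace_ne_zero hφ h1.symm
    choose! φ' j h1 h2 h3 h4 using fun b => ih b (measProj q b *ᵥ φ)
    -- The most frugal among the outcomes of positive probability.
    obtain ⟨b, hb, hmin⟩ := Set.exists_min_image {b | measProj q b *ᵥ φ ≠ 0} j (Set.toFinite _) hex
    refine ⟨φ' b, j b, h1 b hb, ?_, ?_, fun w hw => ?_⟩
    · rw [expectedT, ← htr, Finset.mul_sum]
      refine Finset.sum_le_sum fun d _ => ?_
      by_cases hd : measProj q d *ᵥ φ = 0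
      · simp [hd, ketbra]
      · rw [conjMap_ketbra]
        refine le_trans ?_ (h2 d hd)
        gcongr
        exact hmin d hd
    · refine le_trans ?_ (h3 b hb)
      rw [measProj_mulVec]
      exact card_stab_le_project hφ q b
    · refine h4 b hb w ?_
      rw [run, sum_mulVec, dotProduct_sum, Finset.sum_eq_zero_iff_of_nonneg] at hw
      · rw [← conjMap_ketbra]
        exact hw b (Finset.mem_univ b)
      · intro d _
        rw [conjMap_ketbra]
        exact ((next d).run_posSemidef (posSemidef_ketbra _)).dotProduct_mulVec_nonneg w
  | random p next ih =>
    intro φ hφ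
    choose φ' j h1 h2 h3 h4 using fun i => ih i φ hφ
    obtain ⟨i, hi, hmin⟩ := exists_minimalFor_of_wellFoundedLT (· ∈ p.support) j p.support_nonempty
    have hmin' : ∀ i' ∈ p.support, j i ≤ j i' := fun i' hi' => by
      rcases le_total (j i) (j i') with h | h
      · exact h
      · exact hmin hi' h
    refine ⟨φ' i, j i, h1 i, ?_, h3 i, fun w hw => ?_⟩
    · rw [expectedT, ← one_mul ((j i : ℝ≥0∞) * _), ← p.tsum_coe, ← ENNReal.tsum_mul_right]
      refine ENNReal.tsum_le_tsum fun i' => ?_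
      by_cases hi' : p i' = 0
      · simp [hi']
      · refine mul_le_mul_right ?_ _
        refine le_trans ?_ (h2 i')
        gcongr
        exact hmin' i' hi'
    · refine h4 i w ?_
      have hs := (summable_run p next (posSemidef_ketbra φ) (ketbra_trace_ne_zero hφ)).hasSum
      let F : Op (Q → Bool) →+ ℂ := ⟨⟨fun M => star w ⬝ᵥ (M *ᵥ w), by simp⟩, fun M N => by
        simp [Matrix.add_mulVec, dotProduct_add]⟩
      have hF : Continuous F := by
        change Continuous fun M : Op (Q → Bool) => star w ⬝ᵥ (M *ᵥ w)
        fun_prop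
      have h5 := hs.map F hF
      have h6 : F (∑' i, ((p i).toReal : ℂ) • (next i).run (ketbra φ)) = 0 := hw
      rw [h6, hasSum_zero_iff_of_nonneg] at h5
      · have h7 : star w ⬝ᵥ ((((p i).toReal : ℂ) • (next i).run (ketbra φ)) *ᵥ w) = 0 :=
          congrFun h5 i
        rw [smul_mulVec, dotProduct_smul, smul_eq_mul, mul_eq_zero] at h7
        refine h7.resolve_left ?_
        rw [Complex.ofReal_eq_zero, ENNReal.toReal_eq_zero_iff, not_or]
        exact ⟨hi, p.apply_ne_top i⟩
      · intro i'
        have h7 := (((next i').run_posSemidef (posSemidef_ketbra φ)).smul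
          (Complex.zero_le_real.mpr (ENNReal.toReal_nonneg (a := p i')))).dotProduct_mulVec_nonneg w
        exact h7

end Branch

/-! ### Exact implementations of a unitary -/

section Exact

theorem eq_zero_of_traceNorm_eq_zero {ι : Type} [Fintype ι] [DecidableEq ι] {A : Op ι}
    (h : traceNorm A ≤ 0) : A = 0 := by
  have h1 : (CFC.sqrt (Aᴴ * A)).PosSemidef :=
    Matrix.nonneg_iff_posSemidef.mp (CFC.sqrt_nonneg _)
  have h2 : CFC.sqrt (Aᴴ * A) = 0 := by
    ext i j
    have := (norm_apply_le_trace h1 i j).trans h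
    simpa using this
  have h3 : CFC.sqrt (Aᴴ * A) * CFC.sqrt (Aᴴ * A) = Aᴴ * A :=
    CFC.sqrt_mul_sqrt_self _ (Matrix.posSemidef_conjTranspose_mul_self A).nonneg
  rw [h2, zero_mul] at h3
  exact Matrix.conjTranspose_mul_self_eq_zero.mp h3.symm

theorem eq_of_diamondDist_eq_zero {ι : Type} [Fintype ι] [DecidableEq ι]
    {E₁ E₂ : Op ι →ₗ[ℂ] Op ι} (h : diamondDist E₁ E₂ ≤ 0) {ρ : Op ι} (hρ : IsDensity ρ) :
    E₁ ρ = E₂ ρ := by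
  -- A reference system of no qubits is enough.
  let ρ' : Op (ι × (Fin 0 → Bool)) := ρ.submatrix Prod.fst Prod.fst
  have hρ' : IsDensity ρ' := by
    refine ⟨hρ.1.submatrix _, ?_⟩
    rw [← hρ.2]
    simp [ρ', Matrix.trace, Fintype.sum_prod_type]
  have h1 : ENNReal.ofReal (traceDist (tensorId (Fin 0 → Bool) E₁ ρ')
      (tensorId (Fin 0 → Bool) E₂ ρ')) ≤ 0 := by
    refine le_trans ?_ h
    exact le_iSup_of_le 0 (le_iSup_of_le ρ' (le_iSup_of_le hρ' le_rfl))
  rw [nonpos_iff_eq_zero, ENNReal.ofReal_eq_zero, traceDist] at h1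
  have h2 := sub_eq_zero.mp (eq_zero_of_traceNorm_eq_zero
    (A := tensorId (Fin 0 → Bool) E₁ ρ' - tensorId (Fin 0 → Bool) E₂ ρ') (by linarith))
  ext i j
  exact congrFun (congrFun h2 (i, default)) (j, default)

theorem withAncilla_ketbra {Q : Type} (a : ℕ) (ψ : (Q → Bool) → ℂ) :
    withAncilla a (ketbra ψ) = ketbra fun y : Q ⊕ Fin a → Bool =>
      if ∀ i, y (Sum.inr i) = false then ψ fun q => y (Sum.inl q) else 0 := by
  ext x y
  simp only [withAncilla, ketbra, LinearMap.coe_mk, AddHom.coe_mk, Matrix.of_apply,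
    vecMulVec_apply, Pi.star_apply]
  by_cases hx : ∀ i, x (Sum.inr i) = false <;> by_cases hy : ∀ i, y (Sum.inr i) = false <;>
    simp [hx, hy]

variable {Q : Type} [Fintype Q] [DecidableEq Q]

/-- If the ancillas are discarded from `ρ` and a pure state `α` remains, then a component `φ` of
`ρ` is a product of `α` with a state of the ancillas. -/
theorem exists_slice_eq_smul {a : ℕ} {ρ : Op (Q ⊕ Fin a → Bool)} (hρ : ρ.PosSemidef)
    {α : (Q → Bool) → ℂ} (hα : α ≠ 0) (htr : traceAncilla a ρ = ketbra α)
    {φ : (Q ⊕ Fin a → Bool) → ℂ}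
    (hφ : ∀ w, star w ⬝ᵥ (ρ *ᵥ w) = 0 → star w ⬝ᵥ φ = 0) (z : Fin a → Bool) :
    ∃ c : ℂ, ∀ x, φ (Sum.elim x z) = c * α x := by
  -- It suffices that every `v` orthogonal to `α` is orthogonal to the slice of `φ` at `z`.
  have key : ∀ v : (Q → Bool) → ℂ, star v ⬝ᵥ α = 0 →
      star v ⬝ᵥ (fun x => φ (Sum.elim x z)) = 0 := by
    intro v hv
    let ext : (Fin a → Bool) → (Q ⊕ Fin a → Bool) → ℂ := fun t y =>
      if (fun i => y (Sum.inr i)) = t then v fun q => y (Sum.inl q) else 0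
    have hdot : ∀ (t : Fin a → Bool) (φ : (Q ⊕ Fin a → Bool) → ℂ),
        star (ext t) ⬝ᵥ φ = ∑ x, star (v x) * φ (Sum.elim x t) := by
      intro t φ
      simp only [dotProduct, Pi.star_apply]
      rw [← (Equiv.sumArrowEquivProdArrow Q (Fin a) Bool).symm.sum_comp, Fintype.sum_prod_type]
      refine Finset.sum_congr rfl fun x _ => ?_
      rw [Finset.sum_eq_single t]
      · simp [ext, Equiv.sumArrowEquivProdArrow]
      · intro t' _ ht'
        simp [ext, Equiv.sumArrowEquivProdArrow, ht']
      · simp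
    have hmul : ∀ (t : Fin a → Bool) (y : Q ⊕ Fin a → Bool),
        (ρ *ᵥ ext t) y = ∑ x, ρ y (Sum.elim x t) * v x := by
      intro t y
      simp only [mulVec, dotProduct]
      rw [← (Equiv.sumArrowEquivProdArrow Q (Fin a) Bool).symm.sum_comp, Fintype.sum_prod_type]
      refine Finset.sum_congr rfl fun x _ => ?_
      rw [Finset.sum_eq_single t]
      · simp [ext, Equiv.sumArrowEquivProdArrow]
      · intro t' _ ht'
        simp [ext, Equiv.sumArrowEquivProdArrow, ht']
      · simp
    have hsum : ∑ t, star (ext t) ⬝ᵥ (ρ *ᵥ ext t) = 0 := by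
      have h1 : star v ⬝ᵥ (traceAncilla a ρ *ᵥ v) = 0 := by
        rw [htr, star_dotProduct_ketbra_mulVec, hv, zero_mul]
      rw [← h1]
      simp_rw [hdot, hmul]
      simp only [traceAncilla, LinearMap.coe_mk, AddHom.coe_mk, mulVec, dotProduct,
        Matrix.of_apply, Pi.star_apply, Finset.sum_mul, Finset.mul_sum]
      rw [Finset.sum_comm]
      exact Finset.sum_congr rfl fun x _ => Finset.sum_comm
    rw [Finset.sum_eq_zero_iff_of_nonneg fun t _ => hρ.dotProduct_mulVec_nonneg _] at hsum
    have h2 := hφ _ (hsum z (Finset.mem_univ z))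
    rwa [hdot] at h2
  -- Apply this to the rejection of the slice from `α`.
  set s : (Q → Bool) → ℂ := fun x => φ (Sum.elim x z) with hs
  have hαα : star α ⬝ᵥ α ≠ 0 := fun h => hα (dotProduct_star_self_eq_zero.mp h)
  set c : ℂ := (star α ⬝ᵥ s) / (star α ⬝ᵥ α) with hc
  have h1 : star α ⬝ᵥ (s - c • α) = 0 := by
    rw [dotProduct_sub, dotProduct_smul, smul_eq_mul, hc, div_mul_cancel₀ _ hαα, sub_self]
  have h2 : star (s - c • α) ⬝ᵥ α = 0 := by
    rw [star_dotProduct, h1, star_zero]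
  have h3 : star (s - c • α) ⬝ᵥ (s - c • α) = 0 := by
    rw [dotProduct_sub, key _ h2, dotProduct_smul, h2, smul_zero, sub_zero]
  have h4 : s - c • α = 0 := dotProduct_star_self_eq_zero.mp h3
  exact ⟨c, fun x => congrFun (sub_eq_zero.mp h4) x⟩

/-- Ancillas in a product state contribute a factor of at most `2 ^ a` to the stabilizer. -/
theorem card_stab_le_of_slices {a : ℕ} {φ : (Q ⊕ Fin a → Bool) → ℂ} (hφ : φ ≠ 0)
    {α : (Q → Bool) → ℂ}
    (h : ∀ z : Fin a → Bool, ∃ c : ℂ, ∀ x, φ (Sum.elim x z) = c * α x) :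
    (stab φ).card ≤ (stab α).card * 2 ^ a := by
  obtain ⟨y₀, hy₀⟩ := Function.ne_iff.mp hφ
  have hy₀' : φ y₀ ≠ 0 := hy₀
  -- Postselect the ancillas on a basis state that occurs in `φ`.
  refine (card_stab_le_project_finset hy₀' (Finset.univ.map Function.Embedding.inr)).trans ?_
  obtain ⟨c, hc⟩ := h fun i => y₀ (Sum.inr i)
  have hc0 : c ≠ 0 := by
    rintro rfl
    refine hy₀' ?_
    have h1 := hc fun q => y₀ (Sum.inl q)
    rw [zero_mul] at h1
    rw [← h1]
    congr 1
    funext q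
    cases q <;> rfl
  set φ' : (Q ⊕ Fin a → Bool) → ℂ := fun y =>
    if ∀ q ∈ Finset.univ.map Function.Embedding.inr, y q = y₀ q then φ y else 0 with hφ'
  have hin : ∀ x, φ' (Sum.elim x fun i => y₀ (Sum.inr i)) = c * α x := fun x => by
    rw [← hc]
    simp [hφ']
  have hout : ∀ y, φ' y ≠ 0 → ∀ i, y (Sum.inr i) = y₀ (Sum.inr i) := by
    intro y hy i
    by_contra hne
    refine hy ?_
    simp only [hφ']
    refine if_neg fun h => hne (h _ ?_)
    simp
  have hφ'0 : φ' y₀ ≠ 0 := by simp [hφ', hy₀']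
  have hz : ∀ p ∈ stab φ', ∀ i, p.1 (Sum.inr i) = false := by
    intro p hp i
    obtain ⟨d, hd⟩ := mem_stab.mp hp
    have h1 := hout _ (apply_symmDiff_ne_zero (fun h => hφ'0 (congrFun h y₀)) hd hφ'0) i
    rw [Pi.symmDiff_apply] at h1
    cases h2 : y₀ (Sum.inr i) <;> cases h3 : p.1 (Sum.inr i) <;> simp [h2, h3] at h1 ⊢
  have hcard : (stab α).card * 2 ^ a =
      (stab α ×ˢ (Finset.univ : Finset (Fin a → Bool))).card := by simp
  rw [hcard]
  refine Finset.card_le_card_of_injOn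
    (fun p => ((fun q => p.1 (Sum.inl q), fun q => p.2 (Sum.inl q)), fun i => p.2 (Sum.inr i)))
    (fun p hp => ?_) fun p hp p' hp' hpp => ?_
  · rw [Finset.mem_coe] at hp ⊢
    refine Finset.mem_product.mpr ⟨?_, Finset.mem_univ _⟩
    obtain ⟨d, hd⟩ := mem_stab.mp hp
    set σ : ℂ := sgn (fun i => p.2 (Sum.inr i)) fun i => y₀ (Sum.inr i) with hσ
    refine mem_stab.mpr ⟨σ * d, fun x => mul_left_cancel₀ hc0 ?_⟩
    have h1 := hd (Sum.elim x fun i => y₀ (Sum.inr i))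
    have h2 : (Sum.elim x fun i => y₀ (Sum.inr i)) ∆ p.1 =
        Sum.elim (x ∆ fun q => p.1 (Sum.inl q)) fun i => y₀ (Sum.inr i) := by
      funext q
      cases q with
      | inl q => rfl
      | inr i =>
        rw [Pi.symmDiff_apply, hz p hp i]
        simp
    have h3 : sgn p.2 (Sum.elim x fun i => y₀ (Sum.inr i)) =
        sgn (fun q => p.2 (Sum.inl q)) x * σ := by
      rw [sgn, Fintype.prod_sum_type]
      rfl
    rw [h2, hin, hin, h3] at h1
    have h4 : σ * σ = 1 := sgn_mul_self _ _
    linear_combination σ * h1 - (sgn (fun q => p.2 (Sum.inl q)) x * c *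
      α (x ∆ fun q => p.1 (Sum.inl q))) * h4
  · rw [Finset.mem_coe] at hp hp'
    simp only [Prod.mk.injEq, funext_iff] at hpp
    refine Prod.ext (funext fun q => ?_) (funext fun q => ?_)
    · cases q with
      | inl q => exact hpp.1.1 q
      | inr i => rw [hz p hp i, hz p' hp' i]
    · cases q with
      | inl q => exact hpp.1.2 q
      | inr i => exact hpp.2 i

/-- If a circuit implements `ρ ↦ U ρ U†` exactly, then the output of `U` on a product of states
`|0⟩` (on the qubits in `A`) and `|+⟩` has a stabilizer of at least `2 ^ (|Q| - k)` elements for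
some number `k` of `T` gates that does not exceed the worst-case expectation. -/
theorem AdaptiveCircuit.exists_nat_le_worstCaseT {a : ℕ} (c : AdaptiveCircuit (Q ⊕ Fin a))
    {U : Op (Q → Bool)} (hc : diamondDist c.channel (conjMap U) ≤ 0)
    (A : Q → Prop) [DecidablePred A] (r : ℂ)
    (hψ : IsPure (plusZero A r))
    (hU : U *ᵥ plusZero A r ≠ 0) :
    ∃ k : ℕ, (k : ℝ≥0∞) ≤ c.worstCaseT ∧ 2 ^ Fintype.card Q ≤
      2 ^ k * (stab (U *ᵥ plusZero A r)).card := by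
  set ψ : (Q → Bool) → ℂ := plusZero A r with hψdef
  have hψtr : (ketbra ψ).trace = 1 := by
    rw [trace_ketbra, hψ, Complex.ofReal_one]
  set φ : (Q ⊕ Fin a → Bool) → ℂ := fun y =>
    if ∀ i, y (Sum.inr i) = false then ψ fun q => y (Sum.inl q) else 0 with hφdef
  have hφ : withAncilla a (ketbra ψ) = ketbra φ := withAncilla_ketbra a ψ
  have hφtr : (ketbra φ).trace.re = 1 := by
    have h1 : ∑ y, ‖φ y‖ ^ 2 = ∑ y, ‖ψ y‖ ^ 2 := by
      rw [← (Equiv.sumArrowEquivProdArrow Q (Fin a) Bool).symm.sum_comp, Fintype.sum_prod_type]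
      refine Finset.sum_congr rfl fun x _ => ?_
      rw [Finset.sum_eq_single ⊥]
      · simp [hφdef, Equiv.sumArrowEquivProdArrow]
      · intro t _ ht
        have h2 : ¬ ∀ i, t i = false := fun h => ht (funext h)
        simp [hφdef, Equiv.sumArrowEquivProdArrow, h2]
      · simp
    rw [trace_ketbra, Complex.ofReal_re, h1]
    exact hψ
  have hφ0 : φ ≠ 0 := by
    rintro h
    rw [h] at hφtr
    simp [ketbra] at hφtr
  obtain ⟨φ', k, h1, h2, h3, h4⟩ := c.exists_branch φ hφ0
  refine ⟨k, ?_, ?_⟩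
  · rw [hφtr, ENNReal.ofReal_one, mul_one, ← hφ] at h2
    exact h2.trans (le_iSup_of_le ψ (le_iSup_of_le hψ le_rfl))
  · have h5 : traceAncilla a (c.run (ketbra φ)) = ketbra (U *ᵥ ψ) := by
      have h6 := eq_of_diamondDist_eq_zero hc (ρ := ketbra ψ) ⟨posSemidef_ketbra ψ, hψtr⟩
      rw [conjMap_ketbra] at h6
      rw [← h6, ← hφ]
      rfl
    have h6 := card_stab_le_of_slices h1 (exists_slice_eq_smul
      (c.run_posSemidef (posSemidef_ketbra φ)) hU h5 h4)
    have h7 : 2 ^ Fintype.card (Q ⊕ Fin a) ≤ (stab φ).card := by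
      have : DecidablePred (Sum.elim A fun _ : Fin a => True) := fun q => by
        cases q <;> dsimp only [Sum.elim_inl, Sum.elim_inr] <;> infer_instance
      refine (two_pow_card_le_card_stab
        (Sum.elim A fun _ : Fin a => True) r).trans (le_of_eq ?_)
      congr 2
      funext y
      simp only [hφdef, hψdef, plusZero, Sum.forall, Sum.elim_inl, Sum.elim_inr, true_implies]
      by_cases hx : ∀ i, y (Sum.inr i) = false <;> simp [hx]
    rw [Fintype.card_sum, Fintype.card_fin, pow_add] at h7
    have h8 : 2 ^ Fintype.card Q * 2 ^ a ≤ (2 ^ k * (stab (U *ᵥ ψ)).card) * 2 ^ a := by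
      calc _ ≤ (stab φ).card := h7
        _ ≤ 2 ^ k * (stab φ').card := h3
        _ ≤ 2 ^ k * ((stab (U *ᵥ ψ)).card * 2 ^ a) := Nat.mul_le_mul_left _ h6
        _ = _ := by ring
    exact Nat.le_of_mul_le_mul_right h8 (by positivity)

end Exact

/-! ### Periods of a Boolean function and parity decision trees -/

section Parity

variable {n : ℕ}

theorem natCast_zmod_two_eq_iff (m m' : ℕ) : (m : ZMod 2) = m' ↔ (Odd m ↔ Odd m') := by
  rw [ZMod.natCast_eq_natCast_iff', Nat.odd_iff, Nat.odd_iff]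
  omega

/-- The bit strings as the vector space over the field of two elements. -/
def toZMod (x : Fin n → Bool) : Fin n → ZMod 2 := fun i => if x i then 1 else 0

theorem toZMod_bijective : Function.Bijective (toZMod (n := n)) := by
  constructor
  · intro x y h
    funext i
    have h1 := congrFun h i
    cases h2 : x i <;> cases h3 : y i <;> simp [toZMod, h2, h3] at h1 ⊢
  · intro v
    refine ⟨fun i => decide (v i = 1), funext fun i => ?_⟩
    have h : ∀ t : ZMod 2, (if decide (t = 1) = true then 1 else 0) = t := by decide
    exact h (v i)

theorem toZMod_symmDiff (x y : Fin n → Bool) : toZMod (x ∆ y) = toZMod x + toZMod y := by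
  funext i
  have h : ∀ b c : Bool, (if b ∆ c = true then 1 else 0 : ZMod 2) =
      (if b = true then 1 else 0) + if c = true then 1 else 0 := by decide
  exact h (x i) (y i)

theorem dotProduct_toZMod (v : Fin n → ZMod 2) (x : Fin n → Bool) :
    v ⬝ᵥ toZMod x = (((Finset.univ.filter fun i => v i = 1).filter fun i => x i = true).card :
      ZMod 2) := by
  rw [Finset.filter_filter, Finset.card_filter, dotProduct]
  push_cast
  refine Finset.sum_congr rfl fun i _ => ?_
  have h : ∀ t : ZMod 2, ∀ b : Bool, t * (if b = true then 1 else 0) =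
      if t = 1 ∧ b = true then 1 else 0 := by decide
  exact h (v i) (x i)

/-- A function that is constant on the fibres of `m` linear forms is a function of `m`
parities. -/
theorem computedByPDT_of_linearMap (f : (Fin n → Bool) → Bool) {m : ℕ}
    (L : (Fin n → ZMod 2) →ₗ[ZMod 2] (Fin m → ZMod 2))
    (h : ∀ x y, L (toZMod x) = L (toZMod y) → f x = f y) : ComputedByPDT f m := by
  let S : Fin m → Finset (Fin n) := fun j =>
    Finset.univ.filter fun i => LinearMap.toMatrix' L j i = 1
  have hS : ∀ x y, (fun j => xorOn (S j) x) = (fun j => xorOn (S j) y) → f x = f y := by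
    refine fun x y hxy => h x y (funext fun j => ?_)
    have h1 := congrFun hxy j
    simp only [xorOn, decide_eq_decide] at h1
    rw [← LinearMap.toMatrix'_mulVec, ← LinearMap.toMatrix'_mulVec]
    change LinearMap.toMatrix' L j ⬝ᵥ toZMod x = LinearMap.toMatrix' L j ⬝ᵥ toZMod y
    rw [dotProduct_toZMod, dotProduct_toZMod, natCast_zmod_two_eq_iff]
    exact h1
  have hf : Function.FactorsThrough f fun x j => xorOn (S j) x := fun x y hxy => hS x y hxy
  refine ⟨S, Function.extend (fun x j => xorOn (S j) x) f fun _ => false, fun x => ?_⟩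
  exact (hf.extend_apply _ x).symm

/-- The periods of `f`. -/
def periods (f : (Fin n → Bool) → Bool) : Finset (Fin n → Bool) :=
  Finset.univ.filter fun a => ∀ x, f (x ∆ a) = f x

/-- A function with at least `2 ^ (n - k)` periods is a function of `k` parities: the linear forms
that vanish on the periods. -/
theorem pdt_le_of_card_periods (f : (Fin n → Bool) → Bool) {k : ℕ}
    (h : 2 ^ n ≤ 2 ^ k * (periods f).card) : pdt f ≤ k := by
  let V : Submodule (ZMod 2) (Fin n → ZMod 2) :=
    { carrier := toZMod '' {a | ∀ x, f (x ∆ a) = f x}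
      zero_mem' := ⟨⊥, by simp, by funext i; simp [toZMod]⟩
      add_mem' := by
        rintro _ _ ⟨a, ha, rfl⟩ ⟨b, hb, rfl⟩
        refine ⟨a ∆ b, fun x => ?_, toZMod_symmDiff a b⟩
        rw [← symmDiff_assoc, hb, ha]
      smul_mem' := by
        intro t _ ⟨a, ha, hv⟩
        have ht : ∀ t : ZMod 2, t = 0 ∨ t = 1 := by decide
        rcases ht t with rfl | rfl
        · exact ⟨⊥, by simp, by funext i; simp [toZMod]⟩
        · exact ⟨a, ha, by rw [one_smul, hv]⟩ }
  have hcard : (periods f).card = 2 ^ Module.finrank (ZMod 2) V := by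
    have h1 : Nat.card V = 2 ^ Module.finrank (ZMod 2) V := by
      rw [Module.natCard_eq_pow_finrank (K := ZMod 2), Nat.card_zmod]
    rw [← h1]
    change _ = Nat.card (toZMod '' {a | ∀ x, f (x ∆ a) = f x})
    rw [Nat.card_image_of_injective toZMod_bijective.1, Nat.card_eq_card_toFinset]
    congr 1
    ext a
    simp [periods]
  have hn := V.finrank_quotient_add_finrank
  rw [Module.finrank_fin_fun] at hn
  rw [hcard, ← pow_add, Nat.pow_le_pow_iff_right (by norm_num)] at h
  have hpdt : ComputedByPDT f (Module.finrank (ZMod 2) ((Fin n → ZMod 2) ⧸ V)) := by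
    refine computedByPDT_of_linearMap f
      ((Module.finBasis (ZMod 2) ((Fin n → ZMod 2) ⧸ V)).equivFun.toLinearMap ∘ₗ V.mkQ)
      fun x y hxy => ?_
    have h1 : V.mkQ (toZMod x) = V.mkQ (toZMod y) :=
      (Module.finBasis (ZMod 2) ((Fin n → ZMod 2) ⧸ V)).equivFun.injective hxy
    rw [Submodule.mkQ_apply, Submodule.mkQ_apply, Submodule.Quotient.eq] at h1
    obtain ⟨a, ha, hv⟩ := h1
    have h2 : x = y ∆ a := toZMod_bijective.1 (by rw [toZMod_symmDiff, hv]; abel)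
    rw [h2, ha]
  have := Nat.sInf_le (s := {k | ComputedByPDT f k}) hpdt
  change sInf {k | ComputedByPDT f k} ≤ k
  omega

theorem sgn_eq_xorOn (z x : Fin n → Bool) :
    sgn z x = if xorOn (Finset.univ.filter fun i => z i = true) x then -1 else 1 := by
  rw [xorOn, Finset.filter_filter, sgn, Finset.prod_ite, Finset.prod_const, Finset.prod_const_one,
    mul_one]
  simp only [Bool.and_eq_true, decide_eq_true_eq]
  split_ifs with h
  · exact h.neg_one_pow
  · exact (Nat.not_odd_iff_even.mp h).neg_one_pow

/-- An affine function needs only one parity. -/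
theorem pdt_le_one_of_affine (f : (Fin n → Bool) → Bool) (b : Fin n → Bool) (d : ℂ)
    (h : ∀ x, sgn b x * (if f x then -1 else 1) = d) : pdt f ≤ 1 := by
  refine Nat.sInf_le ⟨fun _ => Finset.univ.filter fun i => b i = true,
    fun v => xor (v 0) (f ⊥), fun x => ?_⟩
  have h1 := h x
  rw [← h ⊥, sgn_bot_right, one_mul, sgn_eq_xorOn] at h1
  cases h2 : f x <;> cases h3 : f ⊥ <;>
    cases h4 : xorOn (Finset.univ.filter fun i => b i = true) x <;>
    rw [h2, h3, h4] at h1 <;> norm_num at h1 <;> simp [h4]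

end Parity

/-! ### The superposition over the graph of a Boolean function -/

section Oracle

variable {n : ℕ}

theorem snoc_symmDiff (u a : Fin n → Bool) (v c : Bool) :
    (Fin.snoc u v : Fin (n + 1) → Bool) ∆ (Fin.snoc a c : Fin (n + 1) → Bool) =
      (Fin.snoc (u ∆ a) (v ∆ c) : Fin (n + 1) → Bool) := by
  funext i
  refine Fin.lastCases ?_ (fun i => ?_) i <;> simp [Pi.symmDiff_apply]

theorem sgn_snoc (b u : Fin n → Bool) (d v : Bool) :
    sgn (Fin.snoc b d : Fin (n + 1) → Bool) (Fin.snoc u v : Fin (n + 1) → Bool) =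
      sgn b u * if d && v then -1 else 1 := by
  simp [sgn, Fin.prod_univ_castSucc]

/-- The stabilizer of the superposition of all `|u⟩|f u⟩`: either `f` is affine, or it consists of
operators `X ^ a ⊗ X ^ c` such that the translation by `a` adds the constant `c` to `f`, and hence
is at most twice as large as the set of the periods of `f`. -/
theorem pdt_le_one_or_card_stab_le (f : (Fin n → Bool) → Bool) {r : ℂ} (hr : r ≠ 0)
    {α : (Fin (n + 1) → Bool) → ℂ} (hα : ∀ u v, α (Fin.snoc u v) = if v = f u then r else 0) :
    pdt f ≤ 1 ∨ (stab α).card ≤ 2 * (periods f).card := by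
  rw [or_iff_not_imp_left]
  intro hpdt
  have hα0 : α ≠ 0 := fun h => hr <| by
    have h1 := hα ⊥ (f ⊥)
    rw [h, if_pos rfl] at h1
    exact h1.symm
  have hstab : ∀ a c b d, ((Fin.snoc a c, Fin.snoc b d) :
      (Fin (n + 1) → Bool) × (Fin (n + 1) → Bool)) ∈ stab α →
      (∀ u, f (u ∆ a) = f u ∆ c) ∧ b = ⊥ ∧ d = false := by
    intro a c b d hp
    obtain ⟨e, he⟩ := mem_stab.mp hp
    have h1 : ∀ u, f (u ∆ a) = f u ∆ c := by
      intro u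
      have h2 := apply_symmDiff_ne_zero hα0 he (y := Fin.snoc u (f u))
        (by rw [hα, if_pos rfl]; exact hr)
      rw [snoc_symmDiff, hα] at h2
      by_contra h
      exact h2 (if_neg fun h' => h h'.symm)
    have h2 : ∀ u, sgn b u * (if d && f u then -1 else 1) = e := by
      intro u
      have h3 := he (Fin.snoc u (f u))
      rw [snoc_symmDiff, hα, hα, sgn_snoc, if_pos (h1 u).symm, if_pos rfl] at h3
      exact mul_right_cancel₀ hr h3
    have hd : d = false := by
      by_contra hd
      rw [Bool.not_eq_false] at hd
      refine hpdt (pdt_le_one_of_affine f b e fun u => ?_)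
      simpa [hd] using h2 u
    subst hd
    refine ⟨h1, funext fun i => ?_, rfl⟩
    have h3 := h2 (Function.update ⊥ i true)
    rw [← h2 ⊥, sgn_single_right, sgn_bot_right] at h3
    cases h4 : b i
    · rfl
    · rw [h4] at h3
      norm_num at h3
  have hF : ((stab α).filter fun p => p.1 (Fin.last n) = false).card ≤ (periods f).card := by
    refine Finset.card_le_card_of_injOn (fun p => Fin.init p.1) (fun p hp => ?_)
      fun p hp p' hp' h => ?_
    · rw [Finset.mem_coe, Finset.mem_filter] at hp
      have h1 := (hstab (Fin.init p.1) (p.1 (Fin.last n)) (Fin.init p.2) (p.2 (Fin.last n))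
        (by simpa only [Fin.snoc_init_self] using hp.1)).1
      rw [hp.2] at h1
      simpa [periods] using h1
    · rw [Finset.mem_coe, Finset.mem_filter] at hp hp'
      have h1 := hstab (Fin.init p.1) (p.1 (Fin.last n)) (Fin.init p.2) (p.2 (Fin.last n))
        (by simpa only [Fin.snoc_init_self] using hp.1)
      have h2 := hstab (Fin.init p'.1) (p'.1 (Fin.last n)) (Fin.init p'.2) (p'.2 (Fin.last n))
        (by simpa only [Fin.snoc_init_self] using hp'.1)
      refine Prod.ext ?_ ?_
      · rw [← Fin.snoc_init_self p.1, ← Fin.snoc_init_self p'.1, hp.2, hp'.2]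
        dsimp only at h
        rw [h]
      · rw [← Fin.snoc_init_self p.2, ← Fin.snoc_init_self p'.2, h1.2.1, h1.2.2, h2.2.1, h2.2.2]
  exact (card_stab_le_two_mul_filter α (Fin.last n)).trans (Nat.mul_le_mul_left 2 hF)

theorem oracle_mulVec_snoc (f : (Fin n → Bool) → Bool) (ψ : (Fin (n + 1) → Bool) → ℂ)
    (u : Fin n → Bool) (v : Bool) :
    (oracle f *ᵥ ψ) (Fin.snoc u v) = ψ (Fin.snoc u (xor v (f u))) := by
  simp only [mulVec, dotProduct, oracle, Matrix.of_apply]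
  rw [Finset.sum_eq_single (Fin.snoc u (xor v (f u)))]
  · simp
  · intro x _ hx
    rw [if_neg, zero_mul]
    intro h
    refine hx ?_
    have h1 : u = Fin.init x := by
      have := congrArg Fin.init h
      simpa only [Fin.init_snoc] using this
    have h2 : v = xor (x (Fin.last n)) (f (Fin.init x)) := by
      have := congrFun h (Fin.last n)
      simpa only [Fin.snoc_last] using this
    rw [← Fin.snoc_init_self x, h2, h1]
    simp
  · simp

/-- The state `|+ⁿ⟩|0⟩`, with the amplitude `r = 2 ^ (-n / 2)`. -/
theorem exists_isPure_plus_zero (n : ℕ) : ∃ r : ℂ, r ≠ 0 ∧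
    IsPure (plusZero (fun q => q = Fin.last n) r) := by
  refine ⟨((Real.sqrt (2 ^ n))⁻¹ : ℝ), ?_, ?_⟩
  · rw [Complex.ofReal_ne_zero]
    positivity
  have h1 : ∀ y : Fin (n + 1) → Bool,
      ‖plusZero (fun q => q = Fin.last n) (((Real.sqrt (2 ^ n))⁻¹ : ℝ) : ℂ) y‖ ^ 2 =
        if y (Fin.last n) = false then ((2 : ℝ) ^ n)⁻¹ else 0 := by
    intro y
    simp only [plusZero, forall_eq]
    split_ifs
    · rw [Complex.norm_real, Real.norm_eq_abs, sq_abs, inv_pow, Real.sq_sqrt (by positivity)]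
    · simp
  rw [IsPure]
  simp_rw [h1]
  rw [← (Fin.snocEquiv fun _ : Fin (n + 1) => Bool).sum_comp, Fintype.sum_prod_type,
    Fintype.sum_bool]
  simp [Fin.snocEquiv]

theorem oracle_mulVec_plus_zero (f : (Fin n → Bool) → Bool) (r : ℂ) (u : Fin n → Bool) (v : Bool) :
    (oracle f *ᵥ plusZero (fun q => q = Fin.last n) r) (Fin.snoc u v) =
      if v = f u then r else 0 := by
  rw [oracle_mulVec_snoc]
  simp only [plusZero, forall_eq, Fin.snoc_last]
  cases v <;> cases f u <;> simp

/-- A stabilizer of at least `2 ^ (n + 1 - k)` elements for the superposition of all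
`|u⟩|f u⟩` bounds the parity decision tree complexity of `f`. -/
theorem pdt_le_of_card_stab_oracle (f : (Fin n → Bool) → Bool) {r : ℂ} (hr : r ≠ 0) {k : ℕ}
    (h : 2 ^ Fintype.card (Fin (n + 1)) ≤
      2 ^ k * (stab (oracle f *ᵥ plusZero (fun q => q = Fin.last n) r)).card) : pdt f ≤ k + 1 := by
  rcases pdt_le_one_or_card_stab_le f hr (oracle_mulVec_plus_zero f r) with h1 | h1
  · exact h1.trans (Nat.le_add_left 1 k)
  · refine (pdt_le_of_card_periods f ?_).trans (Nat.le_succ k)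
    have h2 := h.trans (Nat.mul_le_mul_left (2 ^ k) h1)
    rw [Fintype.card_fin, pow_succ, mul_left_comm, mul_comm (2 ^ n)] at h2
    exact Nat.le_of_mul_le_mul_left h2 two_pos

end Oracle

end CliffordT

open CliffordT in
theorem theorem6 (n : ℕ) (f : (Fin n → Bool) → Bool) :
    (CliffordT.pdt f : ENNReal) ≤ CliffordT.adaptiveTCount 0 (CliffordT.oracle f) + 1 := by
  rw [adaptiveTCount, ← tsub_le_iff_right]
  refine le_iInf fun a => le_iInf fun c => le_iInf fun hc => ?_
  rw [ENNReal.coe_zero] at hc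
  obtain ⟨r, hr, hpure⟩ := exists_isPure_plus_zero n
  obtain ⟨k, hk, hcard⟩ := c.exists_nat_le_worstCaseT hc (fun q => q = Fin.last n) r hpure
    fun h => hr <| by
      have h1 := oracle_mulVec_plus_zero f r ⊥ (f ⊥)
      rw [h, if_pos rfl] at h1
      exact h1.symm
  rw [tsub_le_iff_right]
  calc (pdt f : ENNReal) ≤ ((k + 1 : ℕ) : ENNReal) :=
        Nat.cast_le.mpr (pdt_le_of_card_stab_oracle f hr hcard)
    _ = k + 1 := by push_cast; rfl
    _ ≤ _ := add_le_add_left hk 1
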